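/- Let $L\subset\mathbb R^2$ be a lattice and let $\mathcal D$ be a hyperbolic automorphism of the torus $\mathbb R^2/L$. Coordinates are chosen so that the stable direction is horizontal and the unstable direction is vertical; thus $\mathcal D$ is induced by $D=\operatorname{diag}(\mu,\lambda)$ with $|\mu|<1<|\lambda|$ and $D(L)=L$. Given $u,v,p,q>0$ such that $[v,p]$ and $[-u,q]$ generate $L$ over $\mathbb Z$, and a point $t\in\mathbb R^2$, the rectangles $$R_1=t+[0,u]\times[0,p],\qquad R_2=t+[-v,0]\times[0,q]$$ form a bi-partition $\{R_1,R_2\}$ of $\mathbb R^2/L$. Let $J^s$ and $J^u$ be the images in the torus of the union of the horizontal sides, respectively of the vertical sides, of $R_1$ and $R_2$. The bi-partition is a Berg partition of $\mathcal D$ (that is, a Markov partition into two rectangles) if $\mathcal D(J^s)\subset J^s$ and $\mathcal D(J^u)\supset J^u$. For an ordering of the two rectangles, the connectivity matrix $C=(c_{ij})$ is the $2\times2$ matrix in which $c_{ij}$ is the number of translates $R_j+g$, $g\in L$, whose interior meets the interior of $D(R_i)$. **Theorem.** 1. Let $\{R_1,R_2\}$ be a Berg partition of $\mathcal D$ as above,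 with connectivity matrix $C$. Then $e_0=[v,p]$, $f_0=[-u,q]$ is a basis of $L$ in which $\mathcal D$ is represented by the matrix $\pm C^T$, where the sign is the sign of $\operatorname{tr}D$ (it is plus if $\lambda>1$ and minus if $\lambda<-1$). 2. (Adler–Manning) Let $C$ be a $2\times 2$ matrix with nonnegative integer entries such that $\mathcal D$ is represented in some basis of $L$ by $C^T$ or by $-C^T$. Then $\mathcal D$ has a Berg partition whose connectivity matrix, for a suitable ordering of its two rectangles, is $C$. -/

import Mathlib

noncomputable section

/-- A hyperbolic automorphism of the torus `ℝ²/L`, in coordinates whose horizontal axis is the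
stable direction (eigenvalue `mu`) and whose vertical axis is the unstable direction
(eigenvalue `lam`). -/
structure HyperbolicToralAut (L : Submodule ℤ (ℝ × ℝ)) where
  mu : ℝ
  lam : ℝ
  abs_mu_lt_one : |mu| < 1
  one_lt_abs_lam : 1 < |lam|
  map_lattice : L.map
    (((mu • LinearMap.id : ℝ →ₗ[ℝ] ℝ).prodMap (lam • LinearMap.id)).restrictScalars ℤ) = L

namespace HyperbolicToralAut

variable {L : Submodule ℤ (ℝ × ℝ)}

/-- The linear map `(x, y) ↦ (mu x, lam y)` of the plane. -/
def lift (T : HyperbolicToralAut L) : (ℝ × ℝ) →ₗ[ℝ] (ℝ × ℝ) :=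
  (T.mu • LinearMap.id : ℝ →ₗ[ℝ] ℝ).prodMap (T.lam • LinearMap.id)

theorem lift_mem (T : HyperbolicToralAut L) :
    ∀ x ∈ L, (T.lift.restrictScalars ℤ) x ∈ L := fun x hx => by
  have h : (T.lift.restrictScalars ℤ) x ∈ L.map (T.lift.restrictScalars ℤ) :=
    Submodule.mem_map_of_mem hx
  have e : L.map (T.lift.restrictScalars ℤ) = L := T.map_lattice
  rwa [e] at h

/-- The automorphism of the lattice of deck translations. -/
def onLattice (T : HyperbolicToralAut L) : L →ₗ[ℤ] L :=
  (T.lift.restrictScalars ℤ).restrict T.lift_mem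

/-- The induced map of the torus `ℝ²/L`. -/
def toralMap (T : HyperbolicToralAut L) : ((ℝ × ℝ) ⧸ L) →ₗ[ℤ] ((ℝ × ℝ) ⧸ L) :=
  L.mapQ L (T.lift.restrictScalars ℤ) T.lift_mem

/-- The connectivity matrix of two rectangles `R 0`, `R 1` in the plane: the `(i, j)` entry is the
number of lattice translates of `R j` that the image of `R i` overlaps (meets in more than boundary
points). -/
def connectivityMatrix (T : HyperbolicToralAut L) (R : Fin 2 → Set (ℝ × ℝ)) :
    Matrix (Fin 2) (Fin 2) ℕ :=
  fun i j => Set.ncard {g : L |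
    (interior (T.lift '' R i) ∩ interior ((fun x => (g : ℝ × ℝ) + x) '' R j)).Nonempty}

end HyperbolicToralAut

/-- A bi-partition of `ℝ²/L`. The first rectangle has width `u` and height `p`, the second has
width `v` and height `q`. They stand on a common horizontal line, the second one immediately to the
left of the first one, `base` being the common point of their lower sides. -/
structure BiPartition (L : Submodule ℤ (ℝ × ℝ)) where
  u : ℝ
  v : ℝ
  p : ℝ
  q : ℝ
  base : ℝ × ℝ
  u_pos : 0 < u
  v_pos : 0 < v
  p_pos : 0 < p
  q_pos : 0 < q
  lattice_eq : L = Submodule.span ℤ {((v, p) : ℝ × ℝ), ((-u, q) : ℝ × ℝ)}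

namespace BiPartition

variable {L : Submodule ℤ (ℝ × ℝ)}

/-- The left ends of the two rectangles. -/
def left (P : BiPartition L) : Fin 2 → ℝ := ![P.base.1, P.base.1 - P.v]

/-- The right ends of the two rectangles. -/
def right (P : BiPartition L) : Fin 2 → ℝ := ![P.base.1 + P.u, P.base.1]

/-- The common height of the lower sides of the two rectangles. -/
def bottom (P : BiPartition L) : ℝ := P.base.2

/-- The heights of the upper sides of the two rectangles. -/
def top (P : BiPartition L) : Fin 2 → ℝ := ![P.base.2 + P.p, P.base.2 + P.q]

/-- The two closed rectangles in the plane. -/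
def rect (P : BiPartition L) (i : Fin 2) : Set (ℝ × ℝ) :=
  Set.Icc (P.left i) (P.right i) ×ˢ Set.Icc P.bottom (P.top i)

/-- The union in the torus of the horizontal sides of the two rectangles. -/
def horizontalSpine (P : BiPartition L) : Set ((ℝ × ℝ) ⧸ L) :=
  L.mkQ '' ⋃ i, Set.Icc (P.left i) (P.right i) ×ˢ {P.bottom, P.top i}

/-- The union in the torus of the vertical sides of the two rectangles. -/
def verticalSpine (P : BiPartition L) : Set ((ℝ × ℝ) ⧸ L) :=
  L.mkQ '' ⋃ i, {P.left i, P.right i} ×ˢ Set.Icc P.bottom (P.top i)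

/-- A bi-partition is a Berg partition if the horizontal spine is mapped into itself and the
vertical spine is covered by its image. -/
def IsBerg (P : BiPartition L) (T : HyperbolicToralAut L) : Prop :=
  T.toralMap '' P.horizontalSpine ⊆ P.horizontalSpine ∧
    P.verticalSpine ⊆ T.toralMap '' P.verticalSpine

end BiPartition

end

/-! ### The hyperbolic map on the plane and on the torus. -/

namespace HyperbolicToralAut

variable {L : Submodule ℤ (ℝ × ℝ)}

/-! Part 1 rests on the heights `h = (p, q)`. The two spine inclusions force `D(R i)` to cross every
translate of `R j` that it overlaps from bottom to top, while staying between its vertical sides.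
Measuring a vertical segment of `R i` therefore gives `|lam| * h i = ∑ j, c i j * h j`
(`IsBerg.height_eq`). The image of a basis vector of height `h i` is a lattice vector of height `lam
* h i`. Since `p` and `q` are rationally independent (`eq_zero_of_mul_p_add_mul_q`), its integer
coordinates can only be `±c i j`.

For part 2, the first and the second coordinates of the given basis form eigenvectors of `±C` for
`mu` and `lam`. By a Perron argument (`perron_signs`) the former have opposite signs and the latter
equal signs. Up to a common sign and a swap, the basis is thus `[v, p]`, `[-u, q]` and prescribes
the rectangles. It remains to place the base point: it is put on the stable axis with horizontal
coordinate fixed by `D` up to a lattice vector `w`, and `exists_spine_shift` finds a `w` for which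
both spine inclusions hold. The resulting connectivity matrix satisfies the same height relation as
`C`, so rational independence identifies the two. -/

theorem lift_apply (T : HyperbolicToralAut L) (z : ℝ × ℝ) :
    T.lift z = (T.mu * z.1, T.lam * z.2) := by
  simp [lift]

theorem lam_ne_zero (T : HyperbolicToralAut L) : T.lam ≠ 0 := by
  intro h
  have := T.one_lt_abs_lam
  rw [h, abs_zero] at this
  linarith

theorem exists_lift_eq (T : HyperbolicToralAut L) {z : ℝ × ℝ} (hz : z ∈ L) :
    ∃ w ∈ L, T.lift w = z := by
  have h := T.map_lattice
  rw [← h] at hz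
  obtain ⟨w, hw, hwz⟩ := hz
  exact ⟨w, hw, hwz⟩

/-- The map is onto `L`, so `mu = 0` would put the whole lattice on the vertical axis. -/
theorem mu_ne_zero (T : HyperbolicToralAut L) {z : ℝ × ℝ} (hz : z ∈ L) (hz1 : z.1 ≠ 0) :
    T.mu ≠ 0 := by
  obtain ⟨w, -, rfl⟩ := T.exists_lift_eq hz
  intro h
  simp [lift_apply, h] at hz1

theorem lift_injective (T : HyperbolicToralAut L) (hmu : T.mu ≠ 0) :
    Function.Injective T.lift := by
  intro a b h
  simp only [lift_apply, Prod.mk.injEq] at h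
  exact Prod.ext (mul_left_cancel₀ hmu h.1) (mul_left_cancel₀ T.lam_ne_zero h.2)

theorem toralMap_mkQ (T : HyperbolicToralAut L) (z : ℝ × ℝ) :
    T.toralMap (L.mkQ z) = L.mkQ (T.lift z) := rfl

theorem toralMap_injective (T : HyperbolicToralAut L) (hmu : T.mu ≠ 0) :
    Function.Injective T.toralMap := by
  intro a b h
  obtain ⟨a, rfl⟩ := L.mkQ_surjective a
  obtain ⟨b, rfl⟩ := L.mkQ_surjective b
  rw [toralMap_mkQ, toralMap_mkQ] at h
  have h' : T.lift a - T.lift b ∈ L := (Submodule.Quotient.eq L).1 h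
  rw [← map_sub] at h'
  obtain ⟨w, hw, hwe⟩ := T.exists_lift_eq h'
  rw [T.lift_injective hmu hwe] at hw
  exact (Submodule.Quotient.eq L).2 hw

/-- The image of a set under the lift of a hyperbolic automorphism has the image of the interior
as its interior. -/
theorem interior_image_lift (T : HyperbolicToralAut L) (hmu : T.mu ≠ 0) (s : Set (ℝ × ℝ)) :
    interior (T.lift '' s) = T.lift '' interior s := by
  have h : ⇑T.lift = ⇑((Homeomorph.mulLeft₀ T.mu hmu).prodCongr
      (Homeomorph.mulLeft₀ T.lam T.lam_ne_zero)) := by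
    funext z
    ext <;> simp [lift_apply]
  rw [h, Homeomorph.image_interior]

end HyperbolicToralAut

/-! ### Translates of the two rectangles tile the plane. -/

namespace BiPartition

variable {L : Submodule ℤ (ℝ × ℝ)}

theorem mem_lattice_iff (P : BiPartition L) {z : ℝ × ℝ} :
    z ∈ L ↔ ∃ m n : ℤ, z = (m * P.v - n * P.u, m * P.p + n * P.q) := by
  have h : z ∈ L ↔ z ∈ Submodule.span ℤ {((P.v, P.p) : ℝ × ℝ), ((-P.u, P.q) : ℝ × ℝ)} := by
    rw [← P.lattice_eq]
  rw [h, Submodule.mem_span_pair]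
  refine exists_congr fun m => exists_congr fun n => ?_
  rw [eq_comm]
  simp [Prod.ext_iff, sub_eq_add_neg]

theorem mem_vp (P : BiPartition L) : ((P.v, P.p) : ℝ × ℝ) ∈ L :=
  P.mem_lattice_iff.2 ⟨1, 0, by simp⟩

theorem mem_uq (P : BiPartition L) : ((-P.u, P.q) : ℝ × ℝ) ∈ L :=
  P.mem_lattice_iff.2 ⟨0, 1, by simp⟩

theorem mu_ne_zero (P : BiPartition L) (T : HyperbolicToralAut L) : T.mu ≠ 0 :=
  T.mu_ne_zero P.mem_vp P.v_pos.ne'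

/-- The interiors of the two rectangles. -/
def openRect (P : BiPartition L) (i : Fin 2) : Set (ℝ × ℝ) :=
  Set.Ioo (P.left i) (P.right i) ×ˢ Set.Ioo P.bottom (P.top i)

theorem interior_rect (P : BiPartition L) (i : Fin 2) : interior (P.rect i) = P.openRect i := by
  rw [rect, openRect, interior_prod_eq, interior_Icc, interior_Icc]

theorem left_lt_right (P : BiPartition L) (i : Fin 2) : P.left i < P.right i := by
  have := P.u_pos
  have := P.v_pos
  fin_cases i <;> simp [left, right] <;> assumption

theorem bottom_lt_top (P : BiPartition L) (i : Fin 2) : P.bottom < P.top i := by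
  have := P.p_pos
  have := P.q_pos
  fin_cases i <;> simp [bottom, top] <;> assumption

theorem openRect_subset_rect (P : BiPartition L) (i : Fin 2) : P.openRect i ⊆ P.rect i :=
  Set.prod_mono Set.Ioo_subset_Icc_self Set.Ioo_subset_Icc_self

/-- The interior of a rectangle meets no translate of the rectangles other than itself. -/
theorem eq_of_sub_mem_rect (P : BiPartition L) {i k : Fin 2} {z g : ℝ × ℝ} (hg : g ∈ L)
    (hz : z ∈ P.openRect i) (hk : z - g ∈ P.rect k) : g = 0 ∧ i = k := by
  obtain ⟨m, n, rfl⟩ := P.mem_lattice_iff.1 hg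
  have hu := P.u_pos
  have hv := P.v_pos
  have hp := P.p_pos
  have hq := P.q_pos
  obtain ⟨⟨z1, z2⟩, z3, z4⟩ := hz
  obtain ⟨⟨k1, k2⟩, k3, k4⟩ := hk
  simp only [Prod.fst_sub, Prod.snd_sub, bottom] at z1 z2 z3 z4 k1 k2 k3 k4
  -- Replaces the integer coefficients by bounds linear in `u, v, p, q`, so that linear arithmetic
  -- settles each sign pattern.
  have trich : ∀ n : ℤ, n = 0 ∨ (∀ r : ℝ, 0 < r → r ≤ n * r) ∨ (∀ r : ℝ, 0 < r → n * r ≤ -r) := by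
    intro n
    rcases lt_trichotomy n 0 with h | h | h
    · right; right
      intro r hr
      have : (n : ℝ) ≤ -1 := by exact_mod_cast Int.le_sub_one_of_lt h
      nlinarith
    · exact Or.inl h
    · right; left
      intro r hr
      have : (1 : ℝ) ≤ n := by exact_mod_cast h
      nlinarith
  rcases trich m with rfl | hm | hm
  · rcases trich n with rfl | hn | hn
    · refine ⟨by simp, ?_⟩
      fin_cases i <;> fin_cases k <;> simp [left, right, top] at * <;> linarith
    all_goals
      exfalso
      have h1 := hn _ hu
      have h2 := hn _ hq
      fin_cases i <;> fin_cases k <;> simp [left, right, top] at * <;> linarith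
  all_goals
    exfalso
    have h1 := hm _ hv
    have h2 := hm _ hp
    rcases trich n with rfl | hn | hn
    · fin_cases i <;> fin_cases k <;> simp [left, right, top] at * <;> linarith
    all_goals
      have h3 := hn _ hu
      have h4 := hn _ hq
      fin_cases i <;> fin_cases k <;> simp [left, right, top] at * <;> linarith

theorem mem_rect_zero (P : BiPartition L) {z : ℝ × ℝ} : z ∈ P.rect 0 ↔
    (P.base.1 ≤ z.1 ∧ z.1 ≤ P.base.1 + P.u) ∧ P.base.2 ≤ z.2 ∧ z.2 ≤ P.base.2 + P.p :=
  Iff.rfl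

theorem mem_rect_one (P : BiPartition L) {z : ℝ × ℝ} : z ∈ P.rect 1 ↔
    (P.base.1 - P.v ≤ z.1 ∧ z.1 ≤ P.base.1) ∧ P.base.2 ≤ z.2 ∧ z.2 ≤ P.base.2 + P.q :=
  Iff.rfl

theorem exists_sub_mem_rect_of_add (P : BiPartition L) {z g : ℝ × ℝ} (hg : g ∈ L)
    (h : ∃ g' ∈ L, ∃ j, z + g - g' ∈ P.rect j) : ∃ g' ∈ L, ∃ j, z - g' ∈ P.rect j := by
  obtain ⟨g', hg', j, h⟩ := h
  exact ⟨g' - g, L.sub_mem hg' hg, j, by rwa [show z - (g' - g) = z + g - g' by abel]⟩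

/-- The rectangles are towers over an exchange of two intervals: subtracting `(v, p)` over the right
interval or `(-u, q)` over the left one stays in the strip and lowers the point by at least `min p
q`. -/
theorem exists_sub_mem_rect_of_above (P : BiPartition L) (n : ℕ) (z : ℝ × ℝ)
    (h1 : P.base.1 - P.v ≤ z.1) (h2 : z.1 < P.base.1 + P.u) (h3 : P.base.2 ≤ z.2)
    (h4 : z.2 ≤ P.base.2 + n * min P.p P.q) :
    ∃ g ∈ L, ∃ j, z - g ∈ P.rect j := by
  have hu := P.u_pos
  have hv := P.v_pos
  have hp := P.p_pos
  have hq := P.q_pos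
  have hmp := min_le_left P.p P.q
  have hmq := min_le_right P.p P.q
  induction n generalizing z with
  | zero =>
    rw [Nat.cast_zero, zero_mul, add_zero] at h4
    refine ⟨0, L.zero_mem, ?_⟩
    rw [sub_zero]
    rcases le_or_gt P.base.1 z.1 with h | h
    · exact ⟨0, P.mem_rect_zero.2 ⟨⟨h, h2.le⟩, h3, by linarith⟩⟩
    · exact ⟨1, P.mem_rect_one.2 ⟨⟨h1, h.le⟩, h3, by linarith⟩⟩
  | succ n ih =>
    push_cast at h4
    rcases le_or_gt P.base.1 z.1 with h | h
    · rcases le_or_gt z.2 (P.base.2 + P.p) with h' | h'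
      · exact ⟨0, L.zero_mem, 0, by rw [sub_zero]; exact P.mem_rect_zero.2 ⟨⟨h, h2.le⟩, h3, h'⟩⟩
      · refine P.exists_sub_mem_rect_of_add (L.neg_mem P.mem_vp) (ih _ ?_ ?_ ?_ ?_) <;>
          simp only [Prod.fst_add, Prod.snd_add, Prod.fst_neg, Prod.snd_neg] <;> linarith
    · rcases le_or_gt z.2 (P.base.2 + P.q) with h' | h'
      · exact ⟨0, L.zero_mem, 1, by rw [sub_zero]; exact P.mem_rect_one.2 ⟨⟨h1, h.le⟩, h3, h'⟩⟩
      · refine P.exists_sub_mem_rect_of_add (L.neg_mem P.mem_uq) (ih _ ?_ ?_ ?_ ?_) <;>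
          simp only [Prod.fst_add, Prod.snd_add, Prod.fst_neg, Prod.snd_neg] <;> linarith

/-- Here the inverse interval exchange, with break point `base.1 + u - v`, raises the point until it
enters a tower. -/
theorem exists_sub_mem_rect_of_below (P : BiPartition L) (n : ℕ) (z : ℝ × ℝ)
    (h1 : P.base.1 - P.v ≤ z.1) (h2 : z.1 < P.base.1 + P.u) (h3 : z.2 < P.base.2)
    (h4 : P.base.2 ≤ z.2 + n * min P.p P.q) :
    ∃ g ∈ L, ∃ j, z - g ∈ P.rect j := by
  have hu := P.u_pos
  have hv := P.v_pos
  have hmp := min_le_left P.p P.q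
  have hmq := min_le_right P.p P.q
  induction n generalizing z with
  | zero => simp at h4; linarith
  | succ n ih =>
    push_cast at h4
    rcases lt_or_ge z.1 (P.base.1 + P.u - P.v) with h | h
    · refine P.exists_sub_mem_rect_of_add P.mem_vp ?_
      rcases lt_or_ge (z.2 + P.p) P.base.2 with h' | h'
      · refine ih _ ?_ ?_ ?_ ?_ <;> simp only [Prod.fst_add, Prod.snd_add] <;> linarith
      · refine ⟨0, L.zero_mem, 0, P.mem_rect_zero.2 ?_⟩
        simp only [sub_zero, Prod.fst_add, Prod.snd_add]
        refine ⟨⟨?_, ?_⟩, ?_, ?_⟩ <;> linarith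
    · refine P.exists_sub_mem_rect_of_add P.mem_uq ?_
      rcases lt_or_ge (z.2 + P.q) P.base.2 with h' | h'
      · refine ih _ ?_ ?_ ?_ ?_ <;> simp only [Prod.fst_add, Prod.snd_add] <;> linarith
      · refine ⟨0, L.zero_mem, 1, P.mem_rect_one.2 ?_⟩
        simp only [sub_zero, Prod.fst_add, Prod.snd_add]
        refine ⟨⟨?_, ?_⟩, ?_, ?_⟩ <;> linarith

/-- The translates of the two rectangles cover the plane. -/
theorem exists_sub_mem_rect (P : BiPartition L) (z : ℝ × ℝ) :
    ∃ g ∈ L, ∃ j, z - g ∈ P.rect j := by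
  have hm : 0 < min P.p P.q := lt_min P.p_pos P.q_pos
  have hw : 0 < P.u + P.v := add_pos P.u_pos P.v_pos
  -- The lattice vector `(v, p) - (-u, q)` has horizontal part `u + v`, the width of the strip.
  obtain ⟨k, ⟨hk1, hk2⟩, -⟩ := existsUnique_add_zsmul_mem_Ico hw z.1 (P.base.1 - P.v)
  refine P.exists_sub_mem_rect_of_add
    (L.smul_mem k (L.sub_mem P.mem_vp P.mem_uq)) ?_
  set y := z + k • ((P.v, P.p) - (-P.u, P.q)) with hy
  have e : y.1 = z.1 + k • (P.u + P.v) := by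
    simp only [hy, Prod.fst_add, Prod.smul_fst, Prod.fst_sub]
    rw [show P.v - -P.u = P.u + P.v by ring]
  rw [← e] at hk1 hk2
  rcases lt_or_ge y.2 P.base.2 with h | h
  · obtain ⟨n, hn⟩ := exists_nat_ge ((P.base.2 - y.2) / min P.p P.q)
    rw [div_le_iff₀ hm] at hn
    exact P.exists_sub_mem_rect_of_below n y hk1 (by linarith) h (by linarith)
  · obtain ⟨n, hn⟩ := exists_nat_ge ((y.2 - P.base.2) / min P.p P.q)
    rw [div_le_iff₀ hm] at hn
    exact P.exists_sub_mem_rect_of_above n y hk1 (by linarith) h (by linarith)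

end BiPartition

/-! ### Spines, and how images of rectangles cross rectangles. -/

namespace BiPartition

variable {L : Submodule ℤ (ℝ × ℝ)}

theorem mkQ_mem_horizontalSpine (P : BiPartition L) {z : ℝ × ℝ} :
    L.mkQ z ∈ P.horizontalSpine ↔ ∃ g ∈ L, ∃ i, (z - g).1 ∈ Set.Icc (P.left i) (P.right i) ∧
      ((z - g).2 = P.bottom ∨ (z - g).2 = P.top i) := by
  constructor
  · rintro ⟨w, hw, hwz⟩
    obtain ⟨i, hi⟩ := Set.mem_iUnion.1 hw
    have h : w - z ∈ L := (Submodule.Quotient.eq L).1 hwz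
    refine ⟨z - w, by rw [← neg_sub]; exact L.neg_mem h, i, ?_⟩
    rw [sub_sub_cancel]
    exact hi
  · rintro ⟨g, hg, i, hi⟩
    exact ⟨z - g, Set.mem_iUnion.2 ⟨i, hi⟩, (Submodule.Quotient.eq L).2 (by simpa using hg)⟩

theorem mkQ_mem_verticalSpine (P : BiPartition L) {z : ℝ × ℝ} :
    L.mkQ z ∈ P.verticalSpine ↔ ∃ g ∈ L, ∃ i,
      ((z - g).1 = P.left i ∨ (z - g).1 = P.right i) ∧
      (z - g).2 ∈ Set.Icc P.bottom (P.top i) := by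
  constructor
  · rintro ⟨w, hw, hwz⟩
    obtain ⟨i, hi⟩ := Set.mem_iUnion.1 hw
    have h : w - z ∈ L := (Submodule.Quotient.eq L).1 hwz
    refine ⟨z - w, by rw [← neg_sub]; exact L.neg_mem h, i, ?_⟩
    rw [sub_sub_cancel]
    exact hi
  · rintro ⟨g, hg, i, hi⟩
    exact ⟨z - g, Set.mem_iUnion.2 ⟨i, hi⟩, (Submodule.Quotient.eq L).2 (by simpa using hg)⟩

theorem mkQ_notMem_horizontalSpine (P : BiPartition L) {i : Fin 2} {z : ℝ × ℝ}
    (hz : z ∈ P.openRect i) : L.mkQ z ∉ P.horizontalSpine := by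
  rw [mkQ_mem_horizontalSpine]
  rintro ⟨g, hg, k, h1, h2⟩
  have hk : z - g ∈ P.rect k := by
    refine ⟨h1, ?_⟩
    have := P.bottom_lt_top k
    rcases h2 with h | h <;> rw [h] <;> constructor <;> linarith
  obtain ⟨rfl, rfl⟩ := P.eq_of_sub_mem_rect hg hz hk
  rw [sub_zero] at h2
  rcases h2 with h | h
  · exact hz.2.1.ne' h
  · exact hz.2.2.ne h

theorem mkQ_notMem_verticalSpine (P : BiPartition L) {i : Fin 2} {z : ℝ × ℝ}
    (hz : z ∈ P.openRect i) : L.mkQ z ∉ P.verticalSpine := by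
  rw [mkQ_mem_verticalSpine]
  rintro ⟨g, hg, k, h2, h1⟩
  have hk : z - g ∈ P.rect k := by
    refine ⟨?_, h1⟩
    have := P.left_lt_right k
    rcases h2 with h | h <;> rw [h] <;> constructor <;> linarith
  obtain ⟨rfl, rfl⟩ := P.eq_of_sub_mem_rect hg hz hk
  rw [sub_zero] at h2
  rcases h2 with h | h
  · exact hz.1.1.ne' h
  · exact hz.1.2.ne h

/-- The vertical spine is covered by its own image and the toral map is injective, so only spine
points can land on it. -/
theorem IsBerg.lift_notMem_verticalSpine {P : BiPartition L} {T : HyperbolicToralAut L}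
    (h : P.IsBerg T) {i : Fin 2} {z : ℝ × ℝ} (hz : z ∈ P.openRect i) :
    L.mkQ (T.lift z) ∉ P.verticalSpine := by
  intro hv
  obtain ⟨s, hs, hsz⟩ := h.2 hv
  rw [← T.toralMap_mkQ] at hsz
  rw [T.toralMap_injective (P.mu_ne_zero T) hsz] at hs
  exact P.mkQ_notMem_verticalSpine hz hs

theorem IsBerg.lift_mem_horizontalSpine {P : BiPartition L} {T : HyperbolicToralAut L}
    (h : P.IsBerg T) {z : ℝ × ℝ} (hz : L.mkQ z ∈ P.horizontalSpine) :
    L.mkQ (T.lift z) ∈ P.horizontalSpine :=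
  h.1 ⟨_, hz, rfl⟩

theorem _root_.Continuous.mem_Ioo_of_forall_ne {f : ℝ → ℝ} (hf : Continuous f) {a b c d x x' : ℝ}
    (hx : x ∈ Set.Ioo a b) (hx' : x' ∈ Set.Ioo a b) (hfx : f x ∈ Set.Ioo c d)
    (hne : ∀ t ∈ Set.Ioo a b, f t ≠ c ∧ f t ≠ d) : f x' ∈ Set.Ioo c d := by
  have hsub : Set.uIcc x x' ⊆ Set.Ioo a b := Set.ordConnected_Ioo.uIcc_subset hx hx'
  have himg := intermediate_value_uIcc (a := x) (b := x') hf.continuousOn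
  constructor
  · by_contra! hlt
    obtain ⟨t, ht, hte⟩ := himg (Set.mem_uIcc.2 (Or.inr ⟨hlt, hfx.1.le⟩))
    exact (hne t (hsub ht)).1 hte
  · by_contra! hlt
    obtain ⟨t, ht, hte⟩ := himg (Set.mem_uIcc.2 (Or.inl ⟨hfx.2.le, hlt⟩))
    exact (hne t (hsub ht)).2 hte

/-- The lattice vectors `g` such that `R j + g` overlaps the image of `R i`. -/
def crossings (P : BiPartition L) (T : HyperbolicToralAut L) (i j : Fin 2) : Set L :=
  {g | ∃ z ∈ P.openRect i, T.lift z - g ∈ P.openRect j}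

theorem connectivityMatrix_apply (P : BiPartition L) (T : HyperbolicToralAut L) (i j : Fin 2) :
    T.connectivityMatrix P.rect i j = (P.crossings T i j).ncard := by
  rw [HyperbolicToralAut.connectivityMatrix]
  congr 1
  ext g
  have hg : (fun x => (g : ℝ × ℝ) + x) = ⇑(Homeomorph.addLeft (g : ℝ × ℝ)) := rfl
  rw [Set.mem_ofPred_eq, T.interior_image_lift (P.mu_ne_zero T), hg, ← Homeomorph.image_interior,
    interior_rect, interior_rect, Set.image_inter_nonempty_iff]
  constructor
  · rintro ⟨z, hz, w, hw, hwz⟩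
    refine ⟨z, hz, ?_⟩
    rw [← hwz]
    simpa using hw
  · rintro ⟨z, hz, hw⟩
    exact ⟨z, hz, _, hw, by simp⟩

/-- The image of a rectangle does not cross the vertical sides of the rectangles it overlaps. -/
theorem IsBerg.mem_Ioo_of_crossing {P : BiPartition L} {T : HyperbolicToralAut L}
    (h : P.IsBerg T) {i j : Fin 2} {g : L} (hg : g ∈ P.crossings T i j) {x : ℝ}
    (hx : x ∈ Set.Ioo (P.left i) (P.right i)) :
    T.mu * x - (g : ℝ × ℝ).1 ∈ Set.Ioo (P.left j) (P.right j) := by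
  obtain ⟨z, hz, hzj⟩ := hg
  rw [T.lift_apply] at hzj
  refine Continuous.mem_Ioo_of_forall_ne (f := fun x => T.mu * x - (g : ℝ × ℝ).1) (by fun_prop)
    hz.1 hx hzj.1 fun t ht => ?_
  -- Moving horizontally through `z` keeps the image at a height inside `R j + g`; reaching a side
  -- of it would mean meeting the vertical spine.
  have hv := h.lift_notMem_verticalSpine (z := (t, z.2)) ⟨ht, hz.2⟩
  rw [P.mkQ_mem_verticalSpine, T.lift_apply] at hv
  push Not at hv
  have h2 : (T.lam * z.2 - (g : ℝ × ℝ).2) ∈ Set.Icc P.bottom (P.top j) :=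
    Set.Ioo_subset_Icc_self hzj.2
  constructor <;> intro he
  · exact hv g g.2 j (Or.inl he) h2
  · exact hv g g.2 j (Or.inr he) h2

/-- The image of a rectangle crosses the rectangles it overlaps from bottom to top. -/
theorem IsBerg.div_mem_Ioo_of_crossing {P : BiPartition L} {T : HyperbolicToralAut L}
    (h : P.IsBerg T) {i j : Fin 2} {g : L} (hg : g ∈ P.crossings T i j) {s : ℝ}
    (hs : s ∈ Set.Ioo P.bottom (P.top j)) :
    (s + (g : ℝ × ℝ).2) / T.lam ∈ Set.Ioo P.bottom (P.top i) := by
  obtain ⟨z, hz, hzj⟩ := hg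
  rw [T.lift_apply] at hzj
  have hl := T.lam_ne_zero
  refine Continuous.mem_Ioo_of_forall_ne (f := fun s => (s + (g : ℝ × ℝ).2) / T.lam)
    (x := T.lam * z.2 - (g : ℝ × ℝ).2) (by fun_prop) hzj.2 hs ?_ fun t ht => ?_
  · have e : (T.lam * z.2 - (g : ℝ × ℝ).2 + (g : ℝ × ℝ).2) / T.lam = z.2 := by field_simp; ring
    rw [e]
    exact hz.2
  · have hin : (T.mu * z.1 - (g : ℝ × ℝ).1, t) ∈ P.openRect j := ⟨hzj.1, ht⟩
    have hh := P.mkQ_notMem_horizontalSpine hin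
    -- Otherwise a point of a horizontal side of `R i` would be mapped into the interior of `R j +
    -- g`, which misses the horizontal spine.
    have key : ¬ ((t + (g : ℝ × ℝ).2) / T.lam = P.bottom ∨
        (t + (g : ℝ × ℝ).2) / T.lam = P.top i) := by
      intro he
      have hb : L.mkQ (z.1, (t + (g : ℝ × ℝ).2) / T.lam) ∈ P.horizontalSpine :=
        P.mkQ_mem_horizontalSpine.2 ⟨0, L.zero_mem, i, by
          simpa using ⟨Set.Ioo_subset_Icc_self hz.1, he⟩⟩
      have hb' := h.lift_mem_horizontalSpine hb
      refine hh ?_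
      convert hb' using 1
      refine (Submodule.Quotient.eq L).2 ?_
      rw [T.lift_apply]
      convert L.neg_mem g.2 using 1
      ext
      · simp
      · simp only [Prod.snd_sub, Prod.snd_neg]
        field_simp
        ring
    exact not_or.1 key

end BiPartition

/-! ### Heights: the eigenvector equation and rational independence. -/

open MeasureTheory in
/-- If a set of finite measure is, up to a null set, the disjoint union of countably many sets
of finitely many kinds, those of kind `i` having measure `c i > 0`, then there are finitely many
of each kind and the measures add up. -/
theorem MeasureTheory.measureReal_eq_sum_ncard {α ι : Type*} [Countable α] [Fintype ι]
    {X : Type*} [MeasurableSpace X] {μ : Measure X}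
    (S : ι → Set α) (K : ι → α → Set X) (U : Set X) (c : ι → ℝ) (hc : ∀ i, 0 < c i)
    (hK : ∀ i a, MeasurableSet (K i a)) (hμ : ∀ i a, μ (K i a) = ENNReal.ofReal (c i))
    (hdisj : ∀ i i' a a', a ∈ S i → a' ∈ S i' → (K i a ∩ K i' a').Nonempty → i = i' ∧ a = a')
    (hU : U =ᵐ[μ] ⋃ i, ⋃ a ∈ S i, K i a) (hfin : μ U ≠ ⊤) :
    μ.real U = ∑ i, (S i).ncard * c i := by
  have h1 : ∀ i, μ (⋃ a ∈ S i, K i a) = (S i).encard * ENNReal.ofReal (c i) := by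
    intro i
    rw [measure_biUnion (Set.to_countable _) ?_ fun a _ => hK i a]
    · rw [← ENNReal.tsum_set_const]
      exact tsum_congr fun a => hμ i a
    · intro a ha a' ha' hne
      by_contra hnd
      exact hne (hdisj i i a a' ha ha' (Set.not_disjoint_iff_nonempty_inter.1 hnd)).2
  have h2 : μ U = ∑ i, (S i).encard * ENNReal.ofReal (c i) := by
    rw [measure_congr hU, measure_iUnion ?_ ?_, tsum_fintype]
    · exact Finset.sum_congr rfl fun i _ => h1 i
    · intro i i' hne
      by_contra hnd
      obtain ⟨x, hx, hx'⟩ := Set.not_disjoint_iff.1 hnd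
      simp only [Set.mem_iUnion] at hx hx'
      obtain ⟨a, ha, hxa⟩ := hx
      obtain ⟨a', ha', hxa'⟩ := hx'
      exact hne (hdisj i i' a a' ha ha' ⟨x, hxa, hxa'⟩).1
    · exact fun i => MeasurableSet.biUnion (Set.to_countable _) fun a _ => hK i a
  have h3 : ∀ i ∈ Finset.univ, ((S i).encard : ENNReal) * ENNReal.ofReal (c i) ≠ ⊤ := by
    rw [h2] at hfin
    exact (ENNReal.sum_ne_top).1 hfin
  rw [Measure.real, h2, ENNReal.toReal_sum h3]
  refine Finset.sum_congr rfl fun i hi => ?_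
  rw [ENNReal.toReal_mul, ENNReal.toReal_ofReal (hc i).le]
  congr 1
  -- Finiteness matters because `ncard` of an infinite set is `0`.
  have hf : (S i).Finite := by
    by_contra hinf
    refine h3 i hi ?_
    rw [Set.Infinite.encard_eq hinf]
    simp [ENNReal.top_mul, hc i]
  rw [← hf.cast_ncard_eq]
  simp

namespace BiPartition

variable {L : Submodule ℤ (ℝ × ℝ)}

/-- The heights of the two rectangles. -/
def height (P : BiPartition L) : Fin 2 → ℝ := ![P.p, P.q]

theorem height_pos (P : BiPartition L) (i : Fin 2) : 0 < P.height i := by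
  have := P.p_pos
  have := P.q_pos
  fin_cases i <;> simp [height] <;> assumption

theorem top_eq (P : BiPartition L) (i : Fin 2) : P.top i = P.bottom + P.height i := by
  fin_cases i <;> rfl

theorem countable_lattice (P : BiPartition L) : Countable L := by
  refine Set.Countable.to_subtype (s := (L : Set (ℝ × ℝ))) ?_
  refine (Set.countable_range fun mn : ℤ × ℤ =>
    ((mn.1 * P.v - mn.2 * P.u, mn.1 * P.p + mn.2 * P.q) : ℝ × ℝ)).mono ?_
  intro z hz
  obtain ⟨m, n, rfl⟩ := P.mem_lattice_iff.1 hz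
  exact ⟨(m, n), rfl⟩

/-- The image of a rectangle of a Berg partition is stacked from translates of the rectangles. -/
theorem IsBerg.height_eq {P : BiPartition L} {T : HyperbolicToralAut L} (h : P.IsBerg T)
    (i : Fin 2) :
    |T.lam| * P.height i = ∑ j, (T.connectivityMatrix P.rect i j : ℝ) * P.height j := by
  have hl := T.lam_ne_zero
  have hla : 0 < |T.lam| := abs_pos.2 hl
  have := P.countable_lattice
  -- Any vertical line through the interior of `R i` would serve.
  set x := (P.left i + P.right i) / 2
  have hx : x ∈ Set.Ioo (P.left i) (P.right i) := by
    have := P.left_lt_right i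
    constructor <;> simp only [x] <;> linarith
  let K : Fin 2 → L → Set ℝ := fun j g =>
    {y | T.lam * y - (g : ℝ × ℝ).2 ∈ Set.Ioo P.bottom (P.top j)}
  have hK : ∀ j g, K j g = (T.lam * ·) ⁻¹'
      Set.Ioo (P.bottom + (g : ℝ × ℝ).2) (P.top j + (g : ℝ × ℝ).2) := by
    intro j g
    ext y
    simp [K, lt_sub_iff_add_lt, sub_lt_iff_lt_add]
  have key := MeasureTheory.measureReal_eq_sum_ncard (μ := MeasureTheory.volume)
    (P.crossings T i) K (Set.Ioo P.bottom (P.top i)) (fun j => P.height j / |T.lam|)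
    (fun j => div_pos (P.height_pos j) hla)
    (fun j g => by rw [hK]; exact measurable_const_mul _ measurableSet_Ioo)
    (fun j g => ?_) ?_ ?_ ?_
  · rw [Real.volume_real_Ioo_of_le (P.bottom_lt_top i).le, P.top_eq, add_sub_cancel_left] at key
    rw [key, Finset.mul_sum]
    refine Finset.sum_congr rfl fun j _ => ?_
    rw [P.connectivityMatrix_apply]
    field_simp
  · rw [hK, Real.volume_preimage_mul_left hl, Real.volume_Ioo, ← ENNReal.ofReal_mul (abs_nonneg _),
      P.top_eq, abs_inv]
    congr 1
    field_simp
    ring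
  · rintro j k g g' hg hg' ⟨y, hy, hy'⟩
    have hz : ((T.mu * x, T.lam * y) : ℝ × ℝ) - g ∈ P.openRect j :=
      ⟨h.mem_Ioo_of_crossing hg hx, hy⟩
    have hz' : ((T.mu * x, T.lam * y) : ℝ × ℝ) - g' ∈ P.openRect k :=
      ⟨h.mem_Ioo_of_crossing hg' hx, hy'⟩
    have := P.eq_of_sub_mem_rect (g := (g' : ℝ × ℝ) - g) (L.sub_mem g'.2 g.2) hz
      (by rw [sub_sub_sub_cancel_right]; exact P.openRect_subset_rect k hz')
    exact ⟨this.2, Subtype.ext (sub_eq_zero.1 this.1).symm⟩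
  -- The countably many heights whose image is level with a horizontal side of some translate; off
  -- this set the covering of the plane is by open heights.
  · let E : Set ℝ := ⋃ j, ⋃ g : L,
      {(P.bottom + (g : ℝ × ℝ).2) / T.lam, (P.top j + (g : ℝ × ℝ).2) / T.lam}
    have hE : E.Countable := Set.countable_iUnion fun j => Set.countable_iUnion fun g =>
      (Set.toFinite _).countable
    have hEae := hE.ae_notMem MeasureTheory.volume
    filter_upwards [hEae] with y hy
    refine propext ⟨fun hyi => ?_, fun hyi => ?_⟩
    · obtain ⟨g, hg, j, hj⟩ := P.exists_sub_mem_rect (T.lift (x, y))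
      have hv := h.lift_notMem_verticalSpine (z := (x, y)) ⟨hx, hyi⟩
      rw [P.mkQ_mem_verticalSpine] at hv
      push Not at hv
      have h1 : (T.lift (x, y) - g).1 ≠ P.left j := fun he => hv g hg j (Or.inl he) hj.2
      have h2 : (T.lift (x, y) - g).1 ≠ P.right j := fun he => hv g hg j (Or.inr he) hj.2
      have hyE : y ≠ (P.bottom + g.2) / T.lam ∧ y ≠ (P.top j + g.2) / T.lam := by
        constructor <;> intro he <;> refine hy (Set.mem_iUnion.2 ⟨j, Set.mem_iUnion.2 ⟨⟨g, hg⟩, ?_⟩⟩)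
        · exact Or.inl he
        · exact Or.inr he
      rw [Ne, Ne, eq_div_iff hl, eq_div_iff hl] at hyE
      have hj2 := hj.2
      simp only [T.lift_apply, Prod.snd_sub] at hj2
      have hyK : T.lam * y - g.2 ∈ Set.Ioo P.bottom (P.top j) :=
        ⟨lt_of_le_of_ne hj2.1 fun he => hyE.1 (by linarith),
          lt_of_le_of_ne hj2.2 fun he => hyE.2 (by linarith)⟩
      refine Set.mem_iUnion.2 ⟨j, Set.mem_iUnion₂.2 ⟨⟨g, hg⟩, ⟨(x, y), ⟨hx, hyi⟩, ?_⟩, hyK⟩⟩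
      refine ⟨⟨lt_of_le_of_ne hj.1.1 h1.symm, lt_of_le_of_ne hj.1.2 h2⟩, ?_⟩
      simpa [T.lift_apply] using hyK
    · obtain ⟨j, hj⟩ := Set.mem_iUnion.1 hyi
      obtain ⟨g, hg, hyK⟩ := Set.mem_iUnion₂.1 hj
      have := h.div_mem_Ioo_of_crossing hg hyK
      rwa [sub_add_cancel, mul_div_cancel_left₀ _ hl] at this
  · simp

/-- The heights of the two rectangles are rationally independent. -/
theorem eq_zero_of_mul_p_add_mul_q (P : BiPartition L) (T : HyperbolicToralAut L) {m n : ℤ}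
    (h : m * P.p + n * P.q = 0) : m = 0 ∧ n = 0 := by
  have hu := P.u_pos
  have hv := P.v_pos
  have hp := P.p_pos
  have hq := P.q_pos
  set x := m * P.v - n * P.u with hx
  have hz : ((x, 0) : ℝ × ℝ) ∈ L := P.mem_lattice_iff.2 ⟨m, n, by rw [h]⟩
  -- A horizontal lattice vector contracts to `0` under iteration. Once shorter than `u / 2`, it
  -- keeps the centre of the first rectangle within that rectangle, so it must vanish.
  have hk : ∀ k : ℕ, ((T.mu ^ k * x, 0) : ℝ × ℝ) ∈ L := by
    intro k
    induction k with
    | zero => simpa using hz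
    | succ k ih =>
      have h' := T.lift_mem _ ih
      rw [LinearMap.restrictScalars_apply, T.lift_apply] at h'
      simpa [pow_succ', mul_assoc] using h'
  have hlim : Filter.Tendsto (fun k : ℕ => T.mu ^ k * x) Filter.atTop (nhds 0) := by
    simpa using (tendsto_pow_atTop_nhds_zero_of_abs_lt_one T.abs_mu_lt_one).mul_const x
  obtain ⟨k, hk'⟩ := ((Metric.tendsto_nhds.1 hlim) (P.u / 2) (half_pos hu)).exists
  rw [Real.dist_eq, sub_zero, abs_lt] at hk'
  have h0 : ((T.mu ^ k * x, 0) : ℝ × ℝ) = 0 := by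
    refine (P.eq_of_sub_mem_rect (i := 0) (k := 0)
      (z := (P.base.1 + P.u / 2, P.base.2 + P.p / 2)) (hk k) ?_ ?_).1
    · refine ⟨⟨?_, ?_⟩, ?_, ?_⟩ <;> simp [left, right, bottom, top] <;> linarith
    · rw [P.mem_rect_zero]
      refine ⟨⟨?_, ?_⟩, ?_, ?_⟩ <;> simp <;> linarith
  have hx0 : x = 0 := by
    have := congrArg Prod.fst h0
    simpa [P.mu_ne_zero T] using this
  have hd : P.v * P.q + P.u * P.p ≠ 0 := by positivity
  have hm : (m : ℝ) * (P.v * P.q + P.u * P.p) = 0 := by linear_combination P.q * hx0 + P.u * h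
  have hn : (n : ℝ) * (P.v * P.q + P.u * P.p) = 0 := by linear_combination P.v * h - P.p * hx0
  exact ⟨by exact_mod_cast (mul_eq_zero.1 hm).resolve_right hd,
    by exact_mod_cast (mul_eq_zero.1 hn).resolve_right hd⟩

end BiPartition

/-! ### The matrix of the automorphism in the basis of a bi-partition. -/

namespace HyperbolicToralAut

variable {L : Submodule ℤ (ℝ × ℝ)}

theorem toMatrix_eq_iff (T : HyperbolicToralAut L) (b : Module.Basis (Fin 2) ℤ L)
    (M : Matrix (Fin 2) (Fin 2) ℤ) :
    LinearMap.toMatrix b b T.onLattice = M ↔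
      ∀ j, T.lift (b j) = M 0 j • (b 0 : ℝ × ℝ) + M 1 j • (b 1 : ℝ × ℝ) := by
  rw [← LinearEquiv.eq_symm_apply, LinearMap.toMatrix_symm]
  constructor
  · intro h j
    have h' := congrArg (fun f => ((f (b j) : L) : ℝ × ℝ)) h
    simp only [Matrix.toLin_self, Fin.sum_univ_two] at h'
    rw [Submodule.coe_add, Submodule.coe_smul, Submodule.coe_smul] at h'
    exact h'
  · intro h
    refine b.ext fun j => Subtype.ext ?_
    rw [Matrix.toLin_self, Fin.sum_univ_two, Submodule.coe_add, Submodule.coe_smul,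
      Submodule.coe_smul]
    exact h j

theorem sign_trace_lift (T : HyperbolicToralAut L) :
    SignType.sign (LinearMap.trace ℝ (ℝ × ℝ) T.lift) = SignType.sign T.lam := by
  have h : LinearMap.trace ℝ (ℝ × ℝ) T.lift = T.mu + T.lam := by
    rw [lift, LinearMap.trace_prodMap']
    simp
  have hm := abs_lt.1 T.abs_mu_lt_one
  rw [h]
  rcases lt_abs.1 T.one_lt_abs_lam with hl | hl
  · rw [sign_pos (by linarith), sign_pos (by linarith)]
  · rw [sign_neg (by linarith), sign_neg (by linarith)]

end HyperbolicToralAut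

namespace BiPartition

variable {L : Submodule ℤ (ℝ × ℝ)}

/-- The basis of the lattice attached to a bi-partition. -/
theorem exists_basis (P : BiPartition L) : ∃ b : Module.Basis (Fin 2) ℤ L,
    (b 0 : ℝ × ℝ) = (P.v, P.p) ∧ (b 1 : ℝ × ℝ) = (-P.u, P.q) := by
  have hu := P.u_pos
  have hv := P.v_pos
  have hp := P.p_pos
  have hq := P.q_pos
  have hli : LinearIndependent ℤ ![(⟨(P.v, P.p), P.mem_vp⟩ : L), ⟨(-P.u, P.q), P.mem_uq⟩] := by
    rw [LinearIndependent.pair_iff]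
    intro m n h
    have h' := congrArg (Subtype.val) h
    have h1 := congrArg Prod.fst h'
    have h2 := congrArg Prod.snd h'
    simp at h1 h2
    have hd : P.v * P.q + P.u * P.p ≠ 0 := by positivity
    have hm : (m : ℝ) * (P.v * P.q + P.u * P.p) = 0 := by linear_combination P.q * h1 + P.u * h2
    have hn : (n : ℝ) * (P.v * P.q + P.u * P.p) = 0 := by linear_combination P.v * h2 - P.p * h1
    exact ⟨by exact_mod_cast (mul_eq_zero.1 hm).resolve_right hd,
      by exact_mod_cast (mul_eq_zero.1 hn).resolve_right hd⟩
  refine ⟨Module.Basis.mk hli ?_, by rw [Module.Basis.mk_apply]; rfl,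
    by rw [Module.Basis.mk_apply]; rfl⟩
  rintro ⟨z, hz⟩ -
  obtain ⟨m, n, rfl⟩ := P.mem_lattice_iff.1 hz
  simp only [Matrix.range_cons, Matrix.range_empty, Set.union_empty, Set.singleton_union]
  exact Submodule.mem_span_pair.2 ⟨m, n, Subtype.ext (by simp [sub_eq_add_neg])⟩

/-- Second coordinates suffice: by rational independence of the heights they determine both integer
coordinates of a lattice vector. -/
theorem IsBerg.toMatrix_eq {P : BiPartition L} {T : HyperbolicToralAut L} (h : P.IsBerg T)
    {b : Module.Basis (Fin 2) ℤ L} (hb0 : (b 0 : ℝ × ℝ) = (P.v, P.p))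
    (hb1 : (b 1 : ℝ × ℝ) = (-P.u, P.q)) {s : ℤ} (hs : s * s = 1) (hsl : (s : ℝ) * T.lam = |T.lam|) :
    LinearMap.toMatrix b b T.onLattice =
      s • ((T.connectivityMatrix P.rect).map (Nat.cast : ℕ → ℤ)).transpose := by
  rw [T.toMatrix_eq_iff]
  intro j
  have hbj : (b j : ℝ × ℝ).2 = P.height j := by
    fin_cases j
    · exact congrArg Prod.snd hb0
    · exact congrArg Prod.snd hb1
  have hmem : T.lift (b j) ∈ L := T.lift_mem _ (b j).2
  obtain ⟨m, n, hmn⟩ := P.mem_lattice_iff.1 hmem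
  have h2 := congrArg Prod.snd hmn
  simp only [T.lift_apply, hbj] at h2
  have hh := h.height_eq j
  rw [Fin.sum_univ_two] at hh
  simp only [height, Matrix.cons_val_zero, Matrix.cons_val_one] at hh h2
  have h0 : ((s * m - T.connectivityMatrix P.rect j 0 : ℤ) : ℝ) * P.p +
      ((s * n - T.connectivityMatrix P.rect j 1 : ℤ) : ℝ) * P.q = 0 := by
    push_cast
    rw [← hsl] at hh
    linear_combination hh - s * h2
  obtain ⟨hm, hn⟩ := P.eq_zero_of_mul_p_add_mul_q T h0
  have hm' : m = s * T.connectivityMatrix P.rect j 0 := by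
    linear_combination s * hm - m * hs
  have hn' : n = s * T.connectivityMatrix P.rect j 1 := by
    linear_combination s * hn - n * hs
  rw [hmn, hb0, hb1, hm', hn']
  simp [sub_eq_add_neg]

/-! ### Placing the base point so that the spine inclusions hold. -/

/-- The horizontal spine is the image of a single horizontal segment. -/
theorem mkQ_mem_horizontalSpine_iff (P : BiPartition L) {z : ℝ × ℝ} :
    L.mkQ z ∈ P.horizontalSpine ↔
      ∃ g ∈ L, (z - g).1 ∈ Set.Icc (P.base.1 - P.v) (P.base.1 + P.u) ∧ (z - g).2 = P.base.2 := by
  have hu := P.u_pos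
  have hv := P.v_pos
  rw [mkQ_mem_horizontalSpine]
  constructor
  · rintro ⟨g, hg, i, ⟨h1, h2⟩, h3 | h3⟩
    · refine ⟨g, hg, ?_, h3⟩
      fin_cases i <;> simp [left, right] at h1 h2 ⊢ <;> constructor <;> linarith
    · fin_cases i <;> simp [left, right, top] at h1 h2 h3
      -- The upper sides, moved down by the generators, tile the common lower segment in exchanged
      -- order.
      · refine ⟨g + (P.v, P.p), L.add_mem hg P.mem_vp, ?_, ?_⟩
        · simp; constructor <;> linarith
        · simp; linarith
      · refine ⟨g + (-P.u, P.q), L.add_mem hg P.mem_uq, ?_, ?_⟩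
        · simp; constructor <;> linarith
        · simp; linarith
  · rintro ⟨g, hg, ⟨h1, h2⟩, h3⟩
    rcases le_total P.base.1 (z - g).1 with h | h
    · exact ⟨g, hg, 0, ⟨h, h2⟩, Or.inl h3⟩
    · exact ⟨g, hg, 1, ⟨h1, h⟩, Or.inl h3⟩

/-- The vertical spine is the image of a single vertical segment. -/
theorem mkQ_mem_verticalSpine_iff (P : BiPartition L) {z : ℝ × ℝ} :
    L.mkQ z ∈ P.verticalSpine ↔
      ∃ g ∈ L, (z - g).1 = P.base.1 ∧
        (z - g).2 ∈ Set.Icc P.base.2 (P.base.2 + (P.p + P.q)) := by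
  have hp := P.p_pos
  have hq := P.q_pos
  rw [mkQ_mem_verticalSpine]
  constructor
  · rintro ⟨g, hg, i, h3, ⟨h1, h2⟩⟩
    fin_cases i <;> simp [left, right, top, bottom] at h1 h2 h3 <;> rcases h3 with h3 | h3
    · refine ⟨g, hg, by simpa using h3, ?_⟩
      simp; constructor <;> linarith
    · refine ⟨g - (-P.u, P.q), L.sub_mem hg P.mem_uq, ?_, ?_⟩
      · simp; linarith
      · simp; constructor <;> linarith
    · refine ⟨g - (P.v, P.p), L.sub_mem hg P.mem_vp, ?_, ?_⟩
      · simp; linarith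
      · simp; constructor <;> linarith
    · refine ⟨g, hg, by simpa using h3, ?_⟩
      simp; constructor <;> linarith
  · rintro ⟨g, hg, h3, ⟨h1, h2⟩⟩
    rcases le_total (z - g).2 (P.base.2 + P.p) with h | h
    · exact ⟨g, hg, 0, Or.inl h3, h1, h⟩
    · refine ⟨g + (P.v, P.p), L.add_mem hg P.mem_vp, 1, Or.inl ?_, ?_⟩
      · simp [left] at h3 ⊢; linarith
      · simp [bottom, top] at h1 h2 h ⊢; constructor <;> linarith

/-- A criterion for a bi-partition based on the unstable axis to be a Berg partition. -/
theorem isBerg_of_lattice_vector (P : BiPartition L) (T : HyperbolicToralAut L) {w : ℝ × ℝ}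
    (hw : w ∈ L) (hb1 : T.mu * P.base.1 = P.base.1 + w.1) (hb2 : P.base.2 = 0)
    (hx : ∀ x ∈ Set.Icc (-P.v) P.u, w.1 + T.mu * x ∈ Set.Icc (-P.v) P.u)
    (hy : ∀ y ∈ Set.Icc 0 (P.p + P.q), (w.2 + y) / T.lam ∈ Set.Icc 0 (P.p + P.q)) :
    P.IsBerg T := by
  constructor
  · rintro _ ⟨a, ha, rfl⟩
    obtain ⟨z, rfl⟩ := L.mkQ_surjective a
    obtain ⟨g, hg, h1, h2⟩ := P.mkQ_mem_horizontalSpine_iff.1 ha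
    rw [T.toralMap_mkQ, mkQ_mem_horizontalSpine_iff]
    refine ⟨T.lift g, T.lift_mem _ hg, ?_⟩
    rw [← map_sub, T.lift_apply]
    have := hx ((z - g).1 - P.base.1) ⟨by linarith [h1.1], by linarith [h1.2]⟩
    rw [mul_sub, hb1] at this
    refine ⟨⟨by linarith [this.1], by linarith [this.2]⟩, ?_⟩
    rw [h2, hb2, mul_zero]
  · intro a ha
    obtain ⟨z, rfl⟩ := L.mkQ_surjective a
    obtain ⟨g, hg, h1, h2⟩ := P.mkQ_mem_verticalSpine_iff.1 ha
    rw [hb2, zero_add] at h2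
    have := hy _ h2
    refine ⟨L.mkQ (P.base.1, (w.2 + (z - g).2) / T.lam), ?_, ?_⟩
    · rw [mkQ_mem_verticalSpine_iff]
      exact ⟨0, L.zero_mem, by simp, by simpa [hb2] using this⟩
    · rw [T.toralMap_mkQ]
      refine (Submodule.Quotient.eq L).2 ?_
      rw [T.lift_apply, hb1, mul_div_cancel₀ _ T.lam_ne_zero]
      convert L.sub_mem hw hg using 1
      ext
      · simp at h1 ⊢; linarith
      · simp; ring

end BiPartition

namespace HyperbolicToralAut

variable {L : Submodule ℤ (ℝ × ℝ)}

/-- A lattice vector along which the image of the spines has to be moved. -/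
theorem exists_spine_shift (T : HyperbolicToralAut L) (hmu : T.mu ≠ 0) {u v p q s : ℝ} (hu : 0 < u)
    (hv : 0 < v) (hp : 0 < p) (hq : 0 < q) (hs : s = 1 ∨ s = -1) {a b c d : ℕ} (hb : b ≠ 0)
    (hc : c ≠ 0)
    (h1 : T.mu * v = s * (a * v - b * u)) (h2 : -(T.mu * u) = s * (c * v - d * u))
    (h3 : T.lam * p = s * (a * p + b * q)) (h4 : T.lam * q = s * (c * p + d * q)) :
    ∃ m n : ℤ,
      (∀ x ∈ Set.Icc (-v) u, m * v - n * u + T.mu * x ∈ Set.Icc (-v) u) ∧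
      (∀ y ∈ Set.Icc 0 (p + q), (m * p + n * q + y) / T.lam ∈ Set.Icc 0 (p + q)) := by
  have hm := abs_lt.1 T.abs_mu_lt_one
  have hb1 : (1 : ℝ) ≤ b := by exact_mod_cast Nat.one_le_iff_ne_zero.2 hb
  have hc1 : (1 : ℝ) ≤ c := by exact_mod_cast Nat.one_le_iff_ne_zero.2 hc
  have ha0 : (0 : ℝ) ≤ a := a.cast_nonneg
  have hd0 : (0 : ℝ) ≤ d := d.cast_nonneg
  have hbq : q ≤ b * q := by nlinarith
  have hcp : p ≤ c * p := by nlinarith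
  have hap : 0 ≤ a * p := by positivity
  have hdq : 0 ≤ d * q := by positivity
  have hm3 : T.mu * u ≤ u := by nlinarith
  have hm4 : T.mu * v ≤ v := by nlinarith
  have hm2 : -(u + v) ≤ T.mu * (u + v) := by nlinarith
  rcases hs with rfl | rfl
  · have hl : 0 < T.lam := by
      by_contra! hl
      linarith [mul_nonpos_of_nonpos_of_nonneg hl hp.le]
    rcases lt_or_gt_of_ne hmu with hneg | hpos
    -- With `e₀ = (v, p)` and `f₀ = (-u, q)` this is `w = D f₀ - e₀`. The map `x ↦ w.1 + mu * x`
    -- reverses order and sends `u` to `-v`, aligning left ends; `b, c ≥ 1` give the vertical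
    -- bounds.
    · refine ⟨c - 1, d, ?_, ?_⟩
      · rintro x ⟨hx1, hx2⟩
        push_cast
        have e1 := mul_le_mul_of_nonpos_left hx1 hneg.le
        have e2 := mul_le_mul_of_nonpos_left hx2 hneg.le
        constructor <;> linarith
      · rintro y ⟨hy1, hy2⟩
        push_cast
        rw [Set.mem_Icc, le_div_iff₀ hl, div_le_iff₀ hl]
        constructor <;> linarith
    · refine ⟨0, 0, ?_, ?_⟩
      · rintro x ⟨hx1, hx2⟩
        push_cast
        have e1 := mul_le_mul_of_nonneg_left hx1 hpos.le
        have e2 := mul_le_mul_of_nonneg_left hx2 hpos.le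
        constructor <;> linarith
      · rintro y ⟨hy1, hy2⟩
        push_cast
        rw [Set.mem_Icc, le_div_iff₀ hl, div_le_iff₀ hl]
        constructor <;> linarith
  · have hl : T.lam < 0 := by
      by_contra! hl
      linarith [mul_nonneg hl hp.le]
    rcases lt_or_gt_of_ne hmu with hneg | hpos
    · have ha1 : (1 : ℝ) ≤ a := by
        refine Nat.one_le_cast.2 (Nat.one_le_iff_ne_zero.2 ?_)
        rintro rfl
        rw [Nat.cast_zero] at h1
        linarith [mul_neg_of_neg_of_pos hneg hv, mul_pos (zero_lt_one.trans_le hb1) hu]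
      have hd1 : (1 : ℝ) ≤ d := by
        refine Nat.one_le_cast.2 (Nat.one_le_iff_ne_zero.2 ?_)
        rintro rfl
        rw [Nat.cast_zero] at h2
        linarith [mul_neg_of_neg_of_pos hneg hu, mul_pos (zero_lt_one.trans_le hc1) hv]
      have hap : p ≤ a * p := by nlinarith
      have hdq : q ≤ d * q := by nlinarith
      -- Again `w = D f₀ - e₀`, now with `D f₀ = -(c e₀ + d f₀)`.
      refine ⟨-c - 1, -d, ?_, ?_⟩
      · rintro x ⟨hx1, hx2⟩
        push_cast
        have e1 := mul_le_mul_of_nonpos_left hx1 hneg.le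
        have e2 := mul_le_mul_of_nonpos_left hx2 hneg.le
        constructor <;> linarith
      · rintro y ⟨hy1, hy2⟩
        push_cast
        rw [Set.mem_Icc, le_div_iff_of_neg hl, div_le_iff_of_neg hl]
        constructor <;> linarith
    -- Here `w = D e₀ - e₀`: order is preserved and `-v` goes to `-v`.
    · refine ⟨-a - 1, -b, ?_, ?_⟩
      · rintro x ⟨hx1, hx2⟩
        push_cast
        have e1 := mul_le_mul_of_nonneg_left hx1 hpos.le
        have e2 := mul_le_mul_of_nonneg_left hx2 hpos.le
        constructor <;> linarith
      · rintro y ⟨hy1, hy2⟩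
        push_cast
        rw [Set.mem_Icc, le_div_iff_of_neg hl, div_le_iff_of_neg hl]
        constructor <;> linarith

/-- A basis of the lattice in the second and the first quadrant gives rise to a Berg partition. -/
theorem exists_isBerg_of_generators (T : HyperbolicToralAut L) {u v p q s : ℝ} (hu : 0 < u)
    (hv : 0 < v) (hp : 0 < p) (hq : 0 < q)
    (hL : L = Submodule.span ℤ {((v, p) : ℝ × ℝ), ((-u, q) : ℝ × ℝ)})
    (hs : s = 1 ∨ s = -1) {C : Matrix (Fin 2) (Fin 2) ℕ} (hb : C 0 1 ≠ 0) (hc : C 1 0 ≠ 0)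
    (h1 : T.mu * v = s * (C 0 0 * v - C 0 1 * u)) (h2 : -(T.mu * u) = s * (C 1 0 * v - C 1 1 * u))
    (h3 : T.lam * p = s * (C 0 0 * p + C 0 1 * q)) (h4 : T.lam * q = s * (C 1 0 * p + C 1 1 * q)) :
    ∃ P : BiPartition L, P.IsBerg T ∧ T.connectivityMatrix P.rect = C := by
  have hmu : T.mu ≠ 0 := T.mu_ne_zero (z := (v, p))
    (by rw [hL]; exact Submodule.subset_span (by simp)) hv.ne'
  obtain ⟨m, n, hx, hy⟩ := T.exists_spine_shift hmu hu hv hp hq hs hb hc h1 h2 h3 h4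
  -- The abscissa solves `mu * x = x + w.1`, so `D` maps the line of the vertical spine to its
  -- translate by `w`.
  let P : BiPartition L := ⟨u, v, p, q, ((m * v - n * u) / (T.mu - 1), 0), hu, hv, hp, hq, hL⟩
  have hm1 : T.mu - 1 ≠ 0 := by linarith [(abs_lt.1 T.abs_mu_lt_one).2]
  have hP : P.IsBerg T := by
    refine P.isBerg_of_lattice_vector T (P.mem_lattice_iff.2 ⟨m, n, rfl⟩) ?_ rfl hx hy
    simp only [P]
    field_simp
    ring
  refine ⟨P, hP, ?_⟩
  have hsl : |T.lam| = s * T.lam := by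
    rcases hs with rfl | rfl
    · rw [one_mul, abs_of_pos]
      by_contra! hl
      have : 0 ≤ 1 * (C 0 0 * p + C 0 1 * q) := by positivity
      nlinarith [mul_pos (show (0 : ℝ) < C 0 1 by positivity) hq, mul_nonneg (C 0 0).cast_nonneg hp.le]
    · rw [neg_one_mul, abs_of_neg]
      by_contra! hl
      nlinarith [mul_pos (show (0 : ℝ) < C 0 1 by positivity) hq,
        mul_nonneg ((C 0 0).cast_nonneg (α := ℝ)) hp.le]
  have hss : s * s = 1 := by rcases hs with rfl | rfl <;> norm_num
  have row : ∀ i, T.connectivityMatrix P.rect i 0 = C i 0 ∧ T.connectivityMatrix P.rect i 1 = C i 1 := by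
    intro i
    have hh := hP.height_eq i
    rw [Fin.sum_univ_two, hsl] at hh
    have hC : s * T.lam * P.height i = C i 0 * p + C i 1 * q := by
      fin_cases i <;> simp [BiPartition.height, P]
      · linear_combination s * h3 + (C 0 0 * p + C 0 1 * q) * hss
      · linear_combination s * h4 + (C 1 0 * p + C 1 1 * q) * hss
    rw [hC] at hh
    have h0 : ((T.connectivityMatrix P.rect i 0 - C i 0 : ℤ) : ℝ) * P.p +
        ((T.connectivityMatrix P.rect i 1 - C i 1 : ℤ) : ℝ) * P.q = 0 := by
      push_cast
      simp only [BiPartition.height, Matrix.cons_val_zero, Matrix.cons_val_one, P] at hh ⊢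
      linear_combination -hh
    obtain ⟨hm, hn⟩ := P.eq_zero_of_mul_p_add_mul_q T h0
    omega
  ext i j
  fin_cases j
  · exact (row i).1
  · exact (row i).2

end HyperbolicToralAut

/-! ### Perron signs of the eigenvectors. -/

/-- The signs of the eigenvectors of a nonnegative integer matrix whose eigenvalues `s * lam` and
`s * mu` satisfy `0 < |mu| < 1 < |lam|`. -/
theorem perron_signs {mu lam s x1 y1 x2 y2 : ℝ} {a b c d : ℕ} (hmu0 : mu ≠ 0) (hmu : |mu| < 1)
    (hlam : 1 < |lam|) (hs : s = 1 ∨ s = -1)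
    (hx0 : x1 ≠ 0 ∨ y1 ≠ 0) (hy0 : x2 ≠ 0 ∨ y2 ≠ 0)
    (hx : mu * x1 = s * (a * x1 + b * y1)) (hy : mu * y1 = s * (c * x1 + d * y1))
    (hx' : lam * x2 = s * (a * x2 + b * y2)) (hy' : lam * y2 = s * (c * x2 + d * y2)) :
    b ≠ 0 ∧ c ≠ 0 ∧ x1 * y1 < 0 ∧ 0 < x2 * y2 := by
  have hss : s * s = 1 := by rcases hs with rfl | rfl <;> norm_num
  have char : ∀ {r x y : ℝ}, (x ≠ 0 ∨ y ≠ 0) → r * x = s * (a * x + b * y) →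
      r * y = s * (c * x + d * y) → (a - s * r) * (d - s * r) = b * c := by
    intro r x y h0 h1 h2
    have k1 : (a - s * r) * x = -(b * y) := by
      linear_combination -s * h1 - (a * x + b * y) * hss
    have k2 : (d - s * r) * y = -(c * x) := by
      linear_combination -s * h2 - (c * x + d * y) * hss
    rw [← sub_eq_zero]
    rcases h0 with h | h
    · refine (mul_eq_zero.1 (?_ : _ * x = 0)).resolve_right h
      linear_combination (d - s * r) * k1 - b * k2
    · refine (mul_eq_zero.1 (?_ : _ * y = 0)).resolve_right h
      linear_combination (a - s * r) * k2 - c * k1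
  have cm := char hx0 hx hy
  have cl := char hy0 hx' hy'
  have hne : mu - lam ≠ 0 := by
    intro h
    rw [sub_eq_zero.1 h] at hmu
    linarith
  have htr : (a : ℝ) + d = s * (lam + mu) := by
    refine sub_eq_zero.1 ((mul_eq_zero.1 (?_ : s * (mu - lam) * _ = 0)).resolve_left
      (mul_ne_zero (left_ne_zero_of_mul_eq_one hss) hne))
    linear_combination cl - cm
  have hm := abs_lt.1 hmu
  have hsl : s * lam = |lam| := by
    have h0 : (0 : ℝ) ≤ a + d := by positivity
    rw [htr] at h0
    rcases hs with rfl | rfl <;> rcases lt_abs.1 hlam with h | h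
    · rw [abs_of_pos (by linarith), one_mul]
    · linarith
    · linarith
    · rw [abs_of_neg (by linarith), neg_one_mul]
  have hsm : |s * mu| < 1 := by
    rcases hs with rfl | rfl <;> simpa using hmu
  -- As `0 < |mu| < 1`, `s * mu` is no integer; the characteristic equation then excludes `b * c =
  -- 0`.
  have hint : ∀ n : ℕ, (n : ℝ) - s * mu ≠ 0 := by
    intro n hn
    have e := sub_eq_zero.1 hn
    rw [← e, Nat.abs_cast] at hsm
    have hn0 : n = 0 := Nat.lt_one_iff.1 (by exact_mod_cast hsm)
    rw [hn0, Nat.cast_zero] at e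
    rcases mul_eq_zero.1 e.symm with h | h
    · exact left_ne_zero_of_mul_eq_one hss h
    · exact hmu0 h
  have hbc : (b : ℝ) * c ≠ 0 := by
    rw [← cm]
    exact mul_ne_zero (hint a) (hint d)
  have hb : (b : ℝ) ≠ 0 := left_ne_zero_of_mul hbc
  have hc : (c : ℝ) ≠ 0 := right_ne_zero_of_mul hbc
  have hb' : (0 : ℝ) < b := lt_of_le_of_ne b.cast_nonneg hb.symm
  have hbc' : (0 : ℝ) < b * c := lt_of_le_of_ne (by positivity) hbc.symm
  have hsm' := abs_lt.1 hsm
  -- The factors `a - s * lam` and `d - s * lam` have product `b * c > 0` and sum `s * mu - s * lam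
  -- < 0`. The same argument with the roles exchanged gives `ham`.
  have hal : (a : ℝ) - s * lam < 0 := by
    by_contra! h
    have : 0 ≤ (d : ℝ) - s * lam := by
      by_contra! h'
      nlinarith [mul_nonpos_of_nonneg_of_nonpos h h'.le]
    linarith
  have ham : 0 < (a : ℝ) - s * mu := by
    by_contra! h
    have : (d : ℝ) - s * mu ≤ 0 := by
      by_contra! h'
      nlinarith [mul_nonpos_of_nonpos_of_nonneg h h'.le]
    linarith
  have k1 : (a - s * mu) * x1 = -(b * y1) := by
    linear_combination -s * hx - (a * x1 + b * y1) * hss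
  have k2 : (a - s * lam) * x2 = -(b * y2) := by
    linear_combination -s * hx' - (a * x2 + b * y2) * hss
  refine ⟨by exact_mod_cast hb, by exact_mod_cast hc, ?_, ?_⟩
  · have hx1 : x1 ≠ 0 := by
      rintro rfl
      have : (b : ℝ) * y1 = 0 := by linarith
      exact hx0.elim (· rfl) (· ((mul_eq_zero.1 this).resolve_left hb))
    have h1 : 0 < (a - s * mu) * (x1 * x1) := mul_pos ham (mul_self_pos.2 hx1)
    have h2 : (b : ℝ) * (x1 * y1) = -((a - s * mu) * (x1 * x1)) := by
      linear_combination x1 * k1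
    by_contra! h
    have := mul_nonneg hb'.le h
    linarith
  · have hx2 : x2 ≠ 0 := by
      rintro rfl
      have : (b : ℝ) * y2 = 0 := by linarith
      exact hy0.elim (· rfl) (· ((mul_eq_zero.1 this).resolve_left hb))
    have h1 : (a - s * lam) * (x2 * x2) < 0 := mul_neg_of_neg_of_pos hal (mul_self_pos.2 hx2)
    have h2 : (b : ℝ) * (x2 * y2) = -((a - s * lam) * (x2 * x2)) := by
      linear_combination x2 * k2
    by_contra! h
    have := mul_nonpos_of_nonneg_of_nonpos hb'.le h
    linarith

/-- A nonzero linear functional on the plane does not vanish on a lattice. -/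
theorem exists_mem_lattice_apply_ne_zero (L : Submodule ℤ (ℝ × ℝ)) [DiscreteTopology L]
    [IsZLattice ℝ L] {f : (ℝ × ℝ) →ₗ[ℝ] ℝ} (hf : f ≠ 0) : ∃ z ∈ L, f z ≠ 0 := by
  by_contra! h
  refine hf (LinearMap.ker_eq_top.1 (top_unique ?_))
  rw [← IsZLattice.span_top (K := ℝ) (L := L)]
  exact Submodule.span_le.2 h

/-! ### From an arbitrary basis to a Berg partition. -/

namespace HyperbolicToralAut

variable {L : Submodule ℤ (ℝ × ℝ)}

theorem exists_isBerg_of_span_pair [DiscreteTopology L] [IsZLattice ℝ L]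
    (T : HyperbolicToralAut L) {e f : ℝ × ℝ} (hL : L = Submodule.span ℤ {e, f}) {s : ℝ}
    (hs : s = 1 ∨ s = -1) {C : Matrix (Fin 2) (Fin 2) ℕ}
    (he : T.lift e = s • ((C 0 0 : ℝ) • e + (C 0 1 : ℝ) • f))
    (hf : T.lift f = s • ((C 1 0 : ℝ) • e + (C 1 1 : ℝ) • f)) :
    ∃ P : BiPartition L, P.IsBerg T ∧
      ∃ σ : Equiv.Perm (Fin 2), T.connectivityMatrix (P.rect ∘ σ) = C := by
  obtain ⟨z, hz, hz1⟩ := exists_mem_lattice_apply_ne_zero L (f := LinearMap.fst ℝ ℝ ℝ)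
    (fun h => one_ne_zero (LinearMap.congr_fun h (1, 0)))
  obtain ⟨w, hw, hw2⟩ := exists_mem_lattice_apply_ne_zero L (f := LinearMap.snd ℝ ℝ ℝ)
    (fun h => one_ne_zero (LinearMap.congr_fun h (0, 1)))
  have hmu := T.mu_ne_zero hz hz1
  have h1 : e.1 ≠ 0 ∨ f.1 ≠ 0 := by
    by_contra! h
    rw [hL, Submodule.mem_span_pair] at hz
    obtain ⟨m, n, rfl⟩ := hz
    simp [h.1, h.2] at hz1
  have h2 : e.2 ≠ 0 ∨ f.2 ≠ 0 := by
    by_contra! h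
    rw [hL, Submodule.mem_span_pair] at hw
    obtain ⟨m, n, rfl⟩ := hw
    simp [h.1, h.2] at hw2
  have he1 := congrArg Prod.fst he
  have he2 := congrArg Prod.snd he
  have hf1 := congrArg Prod.fst hf
  have hf2 := congrArg Prod.snd hf
  simp only [T.lift_apply, Prod.smul_fst, Prod.smul_snd, Prod.fst_add, Prod.snd_add,
    smul_eq_mul] at he1 he2 hf1 hf2
  obtain ⟨hb, hc, hneg, hpos⟩ := perron_signs hmu T.abs_mu_lt_one T.one_lt_abs_lam hs h1 h2
    he1 hf1 he2 hf2
  clear he hf h1 h2 hz hz1 hw hw2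
  -- Negating both vectors changes neither the lattice nor the matrix.
  wlog hep : 0 < e.2 generalizing e f
  · refine this (e := -e) (f := -f) ?_ ?_ ?_ ?_ ?_ ?_ ?_ ?_
    · rw [hL, ← Submodule.span_neg]
      congr 1
      ext x
      simp
    all_goals simp only [Prod.fst_neg, Prod.snd_neg, neg_mul_neg]
    · linear_combination -he1
    · linear_combination -he2
    · linear_combination -hf1
    · linear_combination -hf2
    · exact hneg
    · exact hpos
    · have : e.2 ≠ 0 := left_ne_zero_of_mul hpos.ne'
      have := lt_of_le_of_ne (not_lt.1 hep) this
      linarith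
  have hfp : 0 < f.2 := pos_of_mul_pos_right hpos hep.le
  rcases mul_neg_iff.1 hneg with ⟨h1, h2⟩ | ⟨h1, h2⟩
  · obtain ⟨P, hP, hPC⟩ := T.exists_isBerg_of_generators (u := -f.1) (v := e.1) (p := e.2)
      (q := f.2) (neg_pos.2 h2) h1 hep hfp (by rw [hL, neg_neg]) hs hb hc
      (by linear_combination he1) (by linear_combination hf1) he2 hf2
    exact ⟨P, hP, Equiv.refl _, hPC⟩
  -- Here the basis vectors trade roles, which conjugates `C` by the swap; this is why an ordering
  -- of the rectangles must be chosen.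
  · obtain ⟨P, hP, hPC⟩ := T.exists_isBerg_of_generators (u := -e.1) (v := f.1) (p := f.2)
      (q := e.2) (C := C.submatrix (Equiv.swap 0 1) (Equiv.swap 0 1))
      (neg_pos.2 h1) h2 hfp hep (by rw [hL, neg_neg, Set.pair_comm]) hs hc hb
      (by simp; linear_combination hf1) (by simp; linear_combination he1)
      (by simp; linear_combination hf2) (by simp; linear_combination he2)
    refine ⟨P, hP, Equiv.swap 0 1, ?_⟩
    ext i j
    have := congrFun (congrFun hPC (Equiv.swap 0 1 i)) (Equiv.swap 0 1 j)
    rw [Matrix.submatrix_apply, Equiv.swap_apply_self, Equiv.swap_apply_self] at this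
    exact this

end HyperbolicToralAut

theorem mainTheorem2 (L : Submodule ℤ (ℝ × ℝ)) [DiscreteTopology L] [IsZLattice ℝ L]
    (T : HyperbolicToralAut L) :
    (∀ P : BiPartition L, P.IsBerg T →
      ∃ b : Module.Basis (Fin 2) ℤ L,
        (b 0 : ℝ × ℝ) = (P.v, P.p) ∧ (b 1 : ℝ × ℝ) = (-P.u, P.q) ∧
        LinearMap.toMatrix b b T.onLattice =
          (SignType.sign (LinearMap.trace ℝ (ℝ × ℝ) T.lift) : ℤ) •
            ((T.connectivityMatrix P.rect).map (Nat.cast : ℕ → ℤ)).transpose ∧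
        (1 < T.lam → LinearMap.toMatrix b b T.onLattice =
          ((T.connectivityMatrix P.rect).map (Nat.cast : ℕ → ℤ)).transpose) ∧
        (T.lam < -1 → LinearMap.toMatrix b b T.onLattice =
          -((T.connectivityMatrix P.rect).map (Nat.cast : ℕ → ℤ)).transpose)) ∧
    (∀ C : Matrix (Fin 2) (Fin 2) ℕ,
      (∃ b : Module.Basis (Fin 2) ℤ L,
        LinearMap.toMatrix b b T.onLattice = (C.map (Nat.cast : ℕ → ℤ)).transpose ∨
        LinearMap.toMatrix b b T.onLattice = -(C.map (Nat.cast : ℕ → ℤ)).transpose) →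
      ∃ P : BiPartition L, P.IsBerg T ∧
        ∃ σ : Equiv.Perm (Fin 2), T.connectivityMatrix (P.rect ∘ σ) = C) := by
  constructor
  · intro P hP
    obtain ⟨b, hb0, hb1⟩ := P.exists_basis
    have hpos : 1 < T.lam → LinearMap.toMatrix b b T.onLattice =
        ((T.connectivityMatrix P.rect).map (Nat.cast : ℕ → ℤ)).transpose := by
      intro hl
      have := hP.toMatrix_eq hb0 hb1 (s := 1) (by norm_num)
        (by rw [abs_of_pos (by linarith)]; simp)
      rwa [one_smul] at this
    have hneg : T.lam < -1 → LinearMap.toMatrix b b T.onLattice =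
        -((T.connectivityMatrix P.rect).map (Nat.cast : ℕ → ℤ)).transpose := by
      intro hl
      have := hP.toMatrix_eq hb0 hb1 (s := -1) (by norm_num)
        (by rw [abs_of_neg (by linarith)]; simp)
      rwa [neg_one_smul] at this
    refine ⟨b, hb0, hb1, ?_, hpos, hneg⟩
    rw [T.sign_trace_lift]
    rcases lt_abs.1 T.one_lt_abs_lam with hl | hl
    · rw [hpos hl, sign_pos (by linarith)]
      simp
    · rw [hneg (by linarith), sign_neg (by linarith)]
      simp
  · rintro C ⟨b, hb⟩
    have hL : L = Submodule.span ℤ {(b 0 : ℝ × ℝ), (b 1 : ℝ × ℝ)} := by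
      have h := congrArg (Submodule.map L.subtype) b.span_eq
      rw [Submodule.map_span, Submodule.map_top, Submodule.range_subtype, ← Set.range_comp] at h
      refine h.symm.trans (congrArg _ ?_)
      ext x
      simp [Fin.exists_fin_two, eq_comm]
    rw [T.toMatrix_eq_iff, T.toMatrix_eq_iff] at hb
    rcases hb with hb | hb
    · refine T.exists_isBerg_of_span_pair hL (Or.inl rfl) ?_ ?_ <;> rw [hb] <;> ext <;> simp
    · refine T.exists_isBerg_of_span_pair hL (Or.inr rfl) ?_ ?_ <;> rw [hb] <;> ext <;> simp
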